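/- **Model.** Consider $n$ asynchronous processes $p_1,\dots,p_n$, at most $t$ of which are Byzantine; $c\ge n-t$ denotes the number of correct processes in the execution at hand. To *broadcast* an implementation message is to send one copy of it to each of the $n$ processes. The network neither corrupts, creates nor duplicates messages, but a message adversary may suppress, for each broadcast by a correct process, up to $d$ of the copies intended to correct processes; all other copies sent by correct processes to correct processes are eventually received. Processes sign data with unforgeable signatures. The application layer of a correct process $p_i$ mbrb-broadcasts application messages $m$ with sequence numbers $sn$, never using the same sequence number twice. **Algorithm (code for $p_i$).** To mbrb-broadcast $(m,sn)$, $p_i$ signs $(m,sn,i)$, saves the signature, and broadcasts $\mathrm{BUNDLE}(m,sn,i,S)$, where $S$ is the set of all signatures it has saved for $(m,sn,i)$. When $p_i$ receives $\mathrm{BUNDLE}(m,sn,j,\mathit{sigs})$, then, if it has not yet mbrb-delivered any $(-,sn,j)$ and $\mathit{sigs}$ contains the valid signature of $(m,sn,j)$ by $p_j$, it saves all valid signatures for $(m,sn,j)$ in $\mathit{sigs}$; next, if it has not yet signed any $(-,sn,j)$, it signs $(m,sn,j)$, saves this signature, and broadcasts $\mathrm{BUNDLE}(m,sn,j,S)$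 with the set $S$ of all its saved signatures for $(m,sn,j)$; finally, if it has saved strictly more than $\frac{n+t}{2}$ signatures for $(m,sn,j)$, it broadcasts $\mathrm{BUNDLE}(m,sn,j,S)$ with all of them and mbrb-delivers $(m,sn,j)$. **Theorem.** Assume $n>3t+2d$ and put $\ell=c-d$. Every execution of the algorithm satisfies: * *Validity.* If a correct process mbrb-delivers $(m,sn,j)$ and $p_j$ is correct, then $p_j$ has previously mbrb-broadcast $(m,sn)$. * *No-duplication.* For all $sn$ and $j$, a correct process mbrb-delivers at most one triplet $(-,sn,j)$, and at most once. * *No-duplicity.* No two different correct processes mbrb-deliver $(m,sn,j)$ and $(m',sn,j)$ with $m\ne m'$. * *Local delivery.* If a correct process $p_i$ mbrb-broadcasts $(m,sn)$, then at least one correct process eventually mbrb-delivers $(m,sn,i)$. * *Global delivery.* If a correct process mbrb-delivers $(m,sn,j)$, then at least $\ell$ correct processes eventually mbrb-deliver $(m,sn,j)$. * *Message cost.* If a correct process $p_i$ mbrb-broadcasts $(m,sn)$, then correct processes send altogether at most $2n^2$ implementation messages $\mathrm{BUNDLE}(-,sn,i,-)$ (suppressed copies included). * *Time cost.* Suppose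 that local computations take no time and that all implementation messages sent by correct processes to correct processes and not suppressed have the same transfer delay, called a communication step. If a correct process $p_i$ mbrb-broadcasts $(m,sn)$, then at least $\ell$ correct processes mbrb-deliver $(m,sn,i)$ at most $\lambda$ communication steps later, where $$\lambda=\begin{cases}2 & \text{if } d<\dfrac{c-\lfloor\frac{n+t}{2}\rfloor}{\lfloor\frac{n+t}{2}\rfloor+1},\\[2mm] 3 & \text{if } d<c-\sqrt{c\cdot\frac{n+t}{2}},\\[1mm] \text{some integer}>3 & \text{otherwise,}\end{cases}$$ and where the integer of the last case does not depend on the execution. -/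

import Mathlib

namespace MBRB

/-! ### Messages, signatures, local states -/

/-- The triplet `(m, sn, j)`: an application message `m` with sequence number `sn`, attributed
to the sender `p_j`. The `n` participants are identified with `Fin n`. -/
@[ext] structure AppMsg (n : ℕ) (M : Type*) where
  content : M
  sn : ℕ
  sender : Fin n

/-- The (ideal) signature of a triplet by a participant. It is the valid signature for the
triplet `a` by `p_k` exactly if it is equal to `⟨k, a⟩`. -/
@[ext] structure Signature (n : ℕ) (M : Type*) where
  signer : Fin n
  signed : AppMsg n M

/-- The implementation message `BUNDLE(m, sn, j, sigs)`. The set `sigs` may contain signatures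
that are not valid for `(m, sn, j)`: the signatures of other triplets. -/
@[ext] structure Bundle (n : ℕ) (M : Type*) where
  app : AppMsg n M
  sigs : Finset (Signature n M)

/-- What a participant does in a step: it broadcasts an implementation message (that is, it sends
one copy to each of the `n` participants, itself included), or it mbrb-delivers a triplet. -/
inductive Output (n : ℕ) (M : Type*) where
  | broadcast (b : Bundle n M)
  | deliver (a : AppMsg n M)

/-- The local memory of a correct participant: the signatures that it has saved, the triplets that
it has signed itself, and the triplets that it has mbrb-delivered. -/
structure LocalState (n : ℕ) (M : Type*) where
  saved : Finset (Signature n M)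
  signed : Finset (AppMsg n M)
  delivered : Finset (AppMsg n M)

namespace LocalState

variable {n : ℕ} {M : Type*}

/-- Initially nothing is saved, signed or delivered. -/
def init : LocalState n M := ⟨∅, ∅, ∅⟩

/-- `(-, sn, j)` is already mbrb-delivered. -/
def HasDelivered (s : LocalState n M) (sn : ℕ) (j : Fin n) : Prop :=
  ∃ a ∈ s.delivered, a.sn = sn ∧ a.sender = j

/-- `(-, sn, j)` is already signed by the owner of the local state. -/
def HasSigned (s : LocalState n M) (sn : ℕ) (j : Fin n) : Prop :=
  ∃ a ∈ s.signed, a.sn = sn ∧ a.sender = j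

open Classical in
/-- All saved signatures for the triplet `a`. -/
noncomputable def sigsFor (s : LocalState n M) (a : AppMsg n M) : Finset (Signature n M) :=
  s.saved.filter (fun σ => σ.signed = a)

open Classical in
/-- `p_i` signs the triplet `a` and saves its signature. -/
noncomputable def sign (i : Fin n) (a : AppMsg n M) (s : LocalState n M) : LocalState n M :=
  { s with saved := insert ⟨i, a⟩ s.saved, signed := insert a s.signed }

open Classical in
/-- Save all valid signatures for `b.app` among `b.sigs`. -/
noncomputable def saveValid (b : Bundle n M) (s : LocalState n M) : LocalState n M :=
  { s with saved := s.saved ∪ b.sigs.filter (fun σ => σ.signed = b.app) }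

open Classical in
/-- Record the mbrb-delivery of the triplet `a`. -/
noncomputable def markDelivered (a : AppMsg n M) (s : LocalState n M) : LocalState n M :=
  { s with delivered := insert a s.delivered }

end LocalState

/-! ### The algorithm (code for `p_i`) -/

section Algorithm

variable {n : ℕ} {M : Type*}

/-- The operation `mbrb_broadcast(m, sn)` of `p_i`: sign `(m, sn, i)`, then broadcast a bundle with
all saved signatures for it. -/
noncomputable def onInvoke (i : Fin n) (m : M) (sn : ℕ) (s : LocalState n M) :
    LocalState n M × List (Output n M) :=
  (s.sign i ⟨m, sn, i⟩,
    [.broadcast ⟨⟨m, sn, i⟩, (s.sign i ⟨m, sn, i⟩).sigsFor ⟨m, sn, i⟩⟩])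

open Classical in
/-- The forwarding phase of a reception: unless `p_i` has already signed some `(-, sn, j)`, it signs
`a = (m, sn, j)` and broadcasts a bundle with all saved signatures for it. -/
noncomputable def forwardPhase (i : Fin n) (a : AppMsg n M) (s : LocalState n M) :
    LocalState n M × List (Output n M) :=
  if ¬ s.HasSigned a.sn a.sender then
    (s.sign i a, [.broadcast ⟨a, (s.sign i a).sigsFor a⟩])
  else (s, [])

/-- The delivery phase of a reception: if strictly more than `(n + t) / 2` signatures for `a` are
saved, broadcast all of them and mbrb-deliver `a`. -/
noncomputable def deliverPhase (t : ℕ) (a : AppMsg n M) (s : LocalState n M) :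
    LocalState n M × List (Output n M) :=
  if n + t < 2 * (s.sigsFor a).card then
    (s.markDelivered a, [.broadcast ⟨a, s.sigsFor a⟩, .deliver a])
  else (s, [])

open Classical in
/-- The code executed by `p_i` when a bundle is received. -/
noncomputable def onReceive (t : ℕ) (i : Fin n) (b : Bundle n M) (s : LocalState n M) :
    LocalState n M × List (Output n M) :=
  if ¬ s.HasDelivered b.app.sn b.app.sender ∧ (⟨b.app.sender, b.app⟩ : Signature n M) ∈ b.sigs then
    let r₁ := forwardPhase i b.app (s.saveValid b)
    let r₂ := deliverPhase t b.app r₁.1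
    (r₂.1, r₁.2 ++ r₂.2)
  else (s, [])

end Algorithm

/-! ### Executions -/

/-- Identifies an output in an execution: the one at position `pos` in the list of the outputs of
the participant `proc` at step number `step`. -/
@[ext] structure OutputId (n : ℕ) where
  proc : Fin n
  step : ℕ
  pos : ℕ

/-- The events of an execution. -/
inductive Event (n : ℕ) (M : Type*) where
  /-- nothing happens (so that finite executions are covered by infinite sequences) -/
  | idle
  /-- the application layer of `p_i` invokes `mbrb_broadcast(m, sn)` -/
  | invoke (i : Fin n) (m : M) (sn : ℕ)
  /-- `p_i` receives its copy of the bundle `b` that a correct participant broadcast as its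
  output `κ` -/
  | receive (i : Fin n) (b : Bundle n M) (κ : OutputId n)
  /-- `p_i` receives a bundle `b` sent by the Byzantine participant `src` -/
  | receiveByz (i src : Fin n) (b : Bundle n M)

section Trace

variable {n : ℕ} {M : Type*}

/-- How the participant `p_i` in local state `s` reacts to an event. -/
noncomputable def react (t : ℕ) (e : Event n M) (i : Fin n) (s : LocalState n M) :
    LocalState n M × List (Output n M) :=
  match e with
  | .idle => (s, [])
  | .invoke j m sn => if j = i then onInvoke i m sn s else (s, [])
  | .receive j b _ => if j = i then onReceive t i b s else (s, [])
  | .receiveByz j _ b => if j = i then onReceive t i b s else (s, [])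

/-- The local state of each participant just before step `k` in a sequence of events. -/
noncomputable def stateAt (t : ℕ) (event : ℕ → Event n M) : ℕ → Fin n → LocalState n M
  | 0 => fun _ => LocalState.init
  | k + 1 => fun i => (react t (event k) i (stateAt t event k i)).1

/-- The output with a given identifier, if there is one. -/
noncomputable def outputAt (t : ℕ) (event : ℕ → Event n M) (κ : OutputId n) :
    Option (Output n M) :=
  (react t (event κ.step) κ.proc (stateAt t event κ.step κ.proc)).2[κ.pos]?

end Trace

open Classical in
/-- An execution of the algorithm by `n` participants, at most `t` of which are Byzantine, over an
asynchronous network that is subject to a message adversary of power `d`. Steps are atomic and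
interleaved in an arbitrary order. -/
structure Execution (n t d : ℕ) (M : Type*) where
  /-- the set of correct participants -/
  correct : Finset (Fin n)
  /-- the sequence of events -/
  event : ℕ → Event n M
  /-- at most `t` participants are Byzantine -/
  card_correct : n ≤ correct.card + t
  invoke_correct : ∀ k i m sn, event k = .invoke i m sn → i ∈ correct
  /-- a correct participant does not use the same sequence number twice -/
  invoke_once : ∀ k k' i m m' sn,
    event k = .invoke i m sn → event k' = .invoke i m' sn → k = k'
  /-- the network neither corrupts nor creates messages -/
  receive_sent : ∀ k i b κ, event k = .receive i b κ →
    i ∈ correct ∧ κ.proc ∈ correct ∧ κ.step < k ∧ outputAt t event κ = some (.broadcast b)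
  /-- the network does not duplicate messages -/
  receive_once : ∀ k k' i b b' κ,
    event k = .receive i b κ → event k' = .receive i b' κ → k = k'
  /-- Byzantine participants send arbitrary bundles, except that they cannot forge the signatures
  of correct participants: such a signature was produced before by its signer -/
  receiveByz_unforged : ∀ k i src b, event k = .receiveByz i src b →
    i ∈ correct ∧ src ∉ correct ∧
      ∀ σ ∈ b.sigs, σ.signer ∈ correct → σ.signed ∈ (stateAt t event k σ.signer).signed
  /-- when a correct participant broadcasts a bundle, the message adversary suppresses at most `d`
  of the copies intended to correct participants; the others are eventually received -/
  adversary : ∀ κ b, κ.proc ∈ correct → outputAt t event κ = some (.broadcast b) →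
    (correct.filter (fun i => ¬ ∃ k, event k = .receive i b κ)).card ≤ d

namespace Execution

variable {n t d : ℕ} {M : Type*}

/-- The effective number of correct participants. -/
def c (E : Execution n t d M) : ℕ := E.correct.card

/-- The output `κ` is the mbrb-delivery of the triplet `a` (by the participant `κ.proc`). -/
def DeliversAt (E : Execution n t d M) (κ : OutputId n) (a : AppMsg n M) : Prop :=
  outputAt t E.event κ = some (.deliver a)

/-- The participant `i` mbrb-delivers the triplet `a`. -/
def Delivers (E : Execution n t d M) (i : Fin n) (a : AppMsg n M) : Prop :=
  ∃ κ : OutputId n, κ.proc = i ∧ E.DeliversAt κ a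

open Classical in
/-- The execution satisfies the specification of the MBRB abstraction with global delivery
guarantee `l`. -/
structure SatisfiesMBRB (E : Execution n t d M) (l : ℕ) : Prop where
  validity : ∀ κ a, κ.proc ∈ E.correct → a.sender ∈ E.correct → E.DeliversAt κ a →
    ∃ k < κ.step, E.event k = .invoke a.sender a.content a.sn
  no_duplication : ∀ κ κ' a a', κ.proc ∈ E.correct → κ.proc = κ'.proc →
    E.DeliversAt κ a → E.DeliversAt κ' a' → a.sn = a'.sn → a.sender = a'.sender → κ = κ'
  no_duplicity : ∀ i i' a a', i ∈ E.correct → i' ∈ E.correct → i ≠ i' →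
    E.Delivers i a → E.Delivers i' a' → a.sn = a'.sn → a.sender = a'.sender → a = a'
  local_delivery : ∀ k i m sn, i ∈ E.correct → E.event k = .invoke i m sn →
    ∃ j ∈ E.correct, E.Delivers j ⟨m, sn, i⟩
  global_delivery : ∀ i a, i ∈ E.correct → E.Delivers i a →
    l ≤ (E.correct.filter (fun j => E.Delivers j a)).card

/-- `time k` is a possible date of step `k` if all messages have the same transfer delay `δ` and
local computations take no time. (Bundles from Byzantine participants may arrive at any time.) -/
structure IsTiming (E : Execution n t d M) (δ : ℝ) (time : ℕ → ℝ) : Prop where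
  delay_pos : 0 < δ
  mono : Monotone time
  delay : ∀ k i b κ, E.event k = .receive i b κ → time k = time κ.step + δ

open Classical in
/-- Whenever a correct participant mbrb-broadcasts an application message, at least `l` correct
participants mbrb-deliver it at most `r` communication steps later, where a communication step
lasts for one transfer delay `δ`. -/
def DeliversWithin (E : Execution n t d M) (δ : ℝ) (time : ℕ → ℝ) (l r : ℕ) : Prop :=
  ∀ k i m sn, i ∈ E.correct → E.event k = .invoke i m sn →
    l ≤ (E.correct.filter (fun j => ∃ κ : OutputId n, κ.proc = j ∧
      E.DeliversAt κ ⟨m, sn, i⟩ ∧ time κ.step ≤ time k + r * δ)).card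

/-- Whenever a correct participant `p_i` mbrb-broadcasts an application message with sequence
number `sn`, correct participants send altogether at most `μ` implementation messages for the
identity `(i, sn)`; each broadcast counts as the sending of `n` messages, one for each addressee. -/
def MessageCostLE (E : Execution n t d M) (μ : ℕ) : Prop :=
  ∀ k i m sn, i ∈ E.correct → E.event k = .invoke i m sn →
    {p : OutputId n × Fin n | p.1.proc ∈ E.correct ∧ ∃ b : Bundle n M,
      outputAt t E.event p.1 = some (.broadcast b) ∧ b.app.sn = sn ∧ b.app.sender = i}.encard ≤ μ

end Execution

end MBRB

/-! Safety rests on quorum intersection. Two sets of more than (n+t)/2 signers share more than t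
participants, hence a correct one. A correct participant signs at most one triplet per identity
(`signed_unique`), so all deliveries of an identity agree (`quorum_unique`). Validity holds because
a bundle is accepted only with the sender's own signature, which a correct sender produces only by
invoking.

Liveness is a count over rounds of communication. Put F = ⌊(n+t)/2⌋, and let s and s' be the numbers
of correct signers before and after a round. The bundle of each signer reaches at least c-d correct
participants, and these all become signers. Thus at least s(c-d) receptions fall on s' participants;
if F·s' < s(c-d), some participant obtains more than F signatures and delivers
(`exists_deliversDuring`). As n > 3t+2d gives F < c-d, it suffices that s' ≤ s. Without time limits
s' = s, which is local delivery. Whoever delivers broadcasts a quorum, and its receivers, at least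
c-d, deliver too (`DeliversDuring.global`).

For the time bounds, at least c-d participants have signed after one step. Counting the missed
bundles then yields the bound 2; the estimate s' ≤ c yields a first delivery after two steps and the
bound 3. In general the number of signers stops growing within n+1 rounds. The message cost holds
because each participant broadcasts at most twice per identity: when it signs and when it delivers.
-/

namespace MBRB

/-! ### Single reactions of a participant -/

section Local

variable {n : ℕ} {M : Type*}

/-- The participant `p_i` receives the bundle `b` in the event `e`. -/
def Event.Receives (e : Event n M) (i : Fin n) (b : Bundle n M) : Prop :=
  (∃ κ, e = .receive i b κ) ∨ ∃ src, e = .receiveByz i src b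

/-- The signatures saved for `a` suffice for the mbrb-delivery of `a`. -/
def LocalState.HasQuorum (t : ℕ) (s : LocalState n M) (a : AppMsg n M) : Prop :=
  n + t < 2 * (s.sigsFor a).card

theorem LocalState.mem_sigsFor {s : LocalState n M} {a : AppMsg n M} {σ : Signature n M} :
    σ ∈ s.sigsFor a ↔ σ ∈ s.saved ∧ σ.signed = a := by
  simp [sigsFor]

/-- The local state after an accepted bundle was saved and, if necessary, signed. -/
noncomputable def afterForward (i : Fin n) (b : Bundle n M) (s : LocalState n M) :
    LocalState n M :=
  (forwardPhase i b.app (s.saveValid b)).1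

theorem react_of_receives {t : ℕ} {e : Event n M} {i : Fin n} {b : Bundle n M}
    (h : e.Receives i b) (s : LocalState n M) : react t e i s = onReceive t i b s := by
  rcases h with ⟨κ, rfl⟩ | ⟨src, rfl⟩ <;> simp [react]

/-- Either nothing happens at `p_i`, or `p_i` invokes an mbrb-broadcast, or it accepts a bundle. -/
theorem react_cases (t : ℕ) (e : Event n M) (i : Fin n) (s : LocalState n M) :
    react t e i s = (s, []) ∨
    (∃ m sn, e = .invoke i m sn ∧ react t e i s = onInvoke i m sn s) ∨
    ∃ b, e.Receives i b ∧ ¬ s.HasDelivered b.app.sn b.app.sender ∧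
      (⟨b.app.sender, b.app⟩ : Signature n M) ∈ b.sigs ∧
      react t e i s = ((deliverPhase t b.app (afterForward i b s)).1,
        (forwardPhase i b.app (s.saveValid b)).2 ++
          (deliverPhase t b.app (afterForward i b s)).2) := by
  have key : ∀ b, e.Receives i b → react t e i s = (s, []) ∨
      (¬ s.HasDelivered b.app.sn b.app.sender ∧
      (⟨b.app.sender, b.app⟩ : Signature n M) ∈ b.sigs ∧
      react t e i s = ((deliverPhase t b.app (afterForward i b s)).1,
        (forwardPhase i b.app (s.saveValid b)).2 ++
          (deliverPhase t b.app (afterForward i b s)).2)) := by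
    intro b hb
    rw [react_of_receives hb, onReceive]
    split_ifs with h
    · exact .inr ⟨h.1, h.2, rfl⟩
    · exact .inl rfl
  cases e with
  | idle => exact .inl rfl
  | invoke j m sn =>
    by_cases h : j = i
    · subst h
      exact .inr (.inl ⟨m, sn, rfl, by simp [react]⟩)
    · exact .inl (by simp [react, h])
  | receive j b κ =>
    by_cases h : j = i
    · subst h
      have hb : (Event.receive j b κ).Receives j b := .inl ⟨κ, rfl⟩
      rcases key b hb with h | h
      · exact .inl h
      · exact .inr (.inr ⟨b, hb, h⟩)
    · exact .inl (by simp [react, h])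
  | receiveByz j src b =>
    by_cases h : j = i
    · subst h
      have hb : (Event.receiveByz j src b).Receives j b := .inr ⟨src, rfl⟩
      rcases key b hb with h | h
      · exact .inl h
      · exact .inr (.inr ⟨b, hb, h⟩)
    · exact .inl (by simp [react, h])

theorem deliverPhase_saved (t : ℕ) (a : AppMsg n M) (s : LocalState n M) :
    (deliverPhase t a s).1.saved = s.saved := by
  unfold deliverPhase; split_ifs <;> rfl

theorem deliverPhase_signed (t : ℕ) (a : AppMsg n M) (s : LocalState n M) :
    (deliverPhase t a s).1.signed = s.signed := by
  unfold deliverPhase; split_ifs <;> rfl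

theorem deliverPhase_sigsFor (t : ℕ) (a a' : AppMsg n M) (s : LocalState n M) :
    (deliverPhase t a s).1.sigsFor a' = s.sigsFor a' := by
  simp [LocalState.sigsFor, deliverPhase_saved]

theorem mem_deliverPhase_delivered {t : ℕ} {a a' : AppMsg n M} {s : LocalState n M} :
    a' ∈ (deliverPhase t a s).1.delivered ↔ a' ∈ s.delivered ∨ (a' = a ∧ s.HasQuorum t a) := by
  unfold deliverPhase LocalState.HasQuorum
  split_ifs with h <;> simp [LocalState.markDelivered, h, or_comm]

theorem afterForward_delivered (i : Fin n) (b : Bundle n M) (s : LocalState n M) :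
    (afterForward i b s).delivered = s.delivered := by
  unfold afterForward forwardPhase; split_ifs <;> rfl

theorem mem_afterForward_saved {i : Fin n} {b : Bundle n M} {s : LocalState n M}
    {σ : Signature n M} :
    σ ∈ (afterForward i b s).saved ↔ σ ∈ s.saved ∨ (σ ∈ b.sigs ∧ σ.signed = b.app) ∨
      (¬ s.HasSigned b.app.sn b.app.sender ∧ σ = ⟨i, b.app⟩) := by
  -- Saving leaves `signed` untouched, so the test of the forwarding phase may be read off the state
  -- before saving.
  have : (s.saveValid b).HasSigned b.app.sn b.app.sender ↔
    s.HasSigned b.app.sn b.app.sender := Iff.rfl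
  unfold afterForward forwardPhase
  rw [this]
  split_ifs with h <;> simp [LocalState.sign, LocalState.saveValid, h]
  tauto

theorem mem_afterForward_signed {i : Fin n} {b : Bundle n M} {s : LocalState n M}
    {a : AppMsg n M} :
    a ∈ (afterForward i b s).signed ↔ a ∈ s.signed ∨
      (¬ s.HasSigned b.app.sn b.app.sender ∧ a = b.app) := by
  have : (s.saveValid b).HasSigned b.app.sn b.app.sender ↔
    s.HasSigned b.app.sn b.app.sender := Iff.rfl
  unfold afterForward forwardPhase
  rw [this]
  split_ifs with h <;> simp [LocalState.sign, LocalState.saveValid, h]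
  tauto

theorem forwardPhase_outputs (i : Fin n) (b : Bundle n M) (s : LocalState n M) :
    (¬ s.HasSigned b.app.sn b.app.sender ∧ (forwardPhase i b.app (s.saveValid b)).2 =
      [.broadcast ⟨b.app, (afterForward i b s).sigsFor b.app⟩]) ∨
    (s.HasSigned b.app.sn b.app.sender ∧ (forwardPhase i b.app (s.saveValid b)).2 = []) := by
  have : (s.saveValid b).HasSigned b.app.sn b.app.sender ↔
    s.HasSigned b.app.sn b.app.sender := Iff.rfl
  unfold afterForward forwardPhase
  rw [this]
  split_ifs with h <;> simp [h]

theorem deliverPhase_outputs (t : ℕ) (a : AppMsg n M) (s : LocalState n M) :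
    (s.HasQuorum t a ∧ (deliverPhase t a s).2 = [.broadcast ⟨a, s.sigsFor a⟩, .deliver a]) ∨
    (¬ s.HasQuorum t a ∧ (deliverPhase t a s).2 = []) := by
  unfold deliverPhase LocalState.HasQuorum
  split_ifs with h <;> simp [h]

theorem react_saved_subset (t : ℕ) (e : Event n M) (i : Fin n) (s : LocalState n M) :
    s.saved ⊆ (react t e i s).1.saved := by
  rcases react_cases t e i s with h | ⟨m, sn, -, h⟩ | ⟨b, -, -, -, h⟩ <;> rw [h]
  · simp [onInvoke, LocalState.sign]
  · intro σ hσ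
    simp [deliverPhase_saved, mem_afterForward_saved, hσ]

theorem react_signed_subset (t : ℕ) (e : Event n M) (i : Fin n) (s : LocalState n M) :
    s.signed ⊆ (react t e i s).1.signed := by
  rcases react_cases t e i s with h | ⟨m, sn, -, h⟩ | ⟨b, -, -, -, h⟩ <;> rw [h]
  · simp [onInvoke, LocalState.sign]
  · intro σ hσ
    simp [deliverPhase_signed, mem_afterForward_signed, hσ]

theorem react_delivered_subset (t : ℕ) (e : Event n M) (i : Fin n) (s : LocalState n M) :
    s.delivered ⊆ (react t e i s).1.delivered := by
  rcases react_cases t e i s with h | ⟨m, sn, -, h⟩ | ⟨b, -, -, -, h⟩ <;> rw [h]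
  · simp [onInvoke, LocalState.sign]
  · intro σ hσ
    simp [mem_deliverPhase_delivered, afterForward_delivered, hσ]

/-- A newly saved signature is one's own new signature or was received. -/
theorem mem_react_saved {t : ℕ} {e : Event n M} {i : Fin n} {s : LocalState n M}
    {σ : Signature n M} (h : σ ∈ (react t e i s).1.saved) :
    σ ∈ s.saved ∨ (σ.signer = i ∧ σ.signed ∈ (react t e i s).1.signed) ∨
      ∃ b, e.Receives i b ∧ σ ∈ b.sigs := by
  rcases react_cases t e i s with hr | ⟨m, sn, -, hr⟩ | ⟨b, hb, -, -, hr⟩ <;> rw [hr] at h ⊢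
  · exact .inl h
  · simp only [onInvoke, LocalState.sign, Finset.mem_insert] at h ⊢
    rcases h with rfl | h
    · simp
    · exact .inl h
  · simp only [deliverPhase_saved, deliverPhase_signed, mem_afterForward_saved,
      mem_afterForward_signed] at h ⊢
    rcases h with h | h | ⟨h, rfl⟩
    · exact .inl h
    · exact .inr (.inr ⟨b, hb, h.1⟩)
    · exact .inr (.inl ⟨rfl, .inr ⟨h, rfl⟩⟩)

/-- A newly signed triplet was invoked, or it was accepted and nothing with the same identity had
been signed. In both cases, a bundle with the new signature is broadcast. -/
theorem mem_react_signed {t : ℕ} {e : Event n M} {i : Fin n} {s : LocalState n M}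
    {a : AppMsg n M} (h : a ∈ (react t e i s).1.signed) :
    a ∈ s.signed ∨
      ((e = .invoke i a.content a.sn ∧ a.sender = i ∨
        ¬ s.HasSigned a.sn a.sender ∧
          ∃ b, e.Receives i b ∧ b.app = a ∧ (⟨a.sender, a⟩ : Signature n M) ∈ b.sigs) ∧
        ∃ S : Finset (Signature n M), ⟨i, a⟩ ∈ S ∧
          (react t e i s).2[0]? = some (.broadcast ⟨a, S⟩)) := by
  rcases react_cases t e i s with hr | ⟨m, sn, he, hr⟩ | ⟨b, hb, -, hs, hr⟩ <;> rw [hr] at h ⊢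
  · exact .inl h
  · simp only [onInvoke, LocalState.sign, Finset.mem_insert] at h ⊢
    rcases h with rfl | h
    · exact .inr ⟨.inl ⟨he, rfl⟩, _, by simp [LocalState.mem_sigsFor], rfl⟩
    · exact .inl h
  · simp only [deliverPhase_signed, mem_afterForward_signed] at h ⊢
    rcases h with h | ⟨h, rfl⟩
    · exact .inl h
    · refine .inr ⟨.inr ⟨h, b, hb, rfl, hs⟩, (afterForward i b s).sigsFor b.app, ?_, ?_⟩
      · simp [LocalState.mem_sigsFor, mem_afterForward_saved, h]
      · rcases forwardPhase_outputs i b s with h' | h'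
        · simp [h'.2]
        · exact absurd h'.1 h

theorem mem_react_delivered {t : ℕ} {e : Event n M} {i : Fin n} {s : LocalState n M}
    {a : AppMsg n M} (h : a ∈ (react t e i s).1.delivered) :
    a ∈ s.delivered ∨ ∃ pos : ℕ, (react t e i s).2[pos]? = some (.deliver a) := by
  rcases react_cases t e i s with hr | ⟨m, sn, -, hr⟩ | ⟨b, -, -, -, hr⟩ <;> rw [hr] at h ⊢
  · exact .inl h
  · exact .inl h
  · simp only [mem_deliverPhase_delivered, afterForward_delivered] at h
    rcases h with h | ⟨rfl, h⟩
    · exact .inl h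
    · right
      rcases deliverPhase_outputs t b.app (afterForward i b s) with h' | h'
      · rw [h'.2]
        refine ⟨(forwardPhase i b.app (s.saveValid b)).2.length + 1, ?_⟩
        simp
      · exact absurd h h'.1

/-- The shape of a reaction with an mbrb-delivery. -/
theorem react_deliver {t : ℕ} {e : Event n M} {i : Fin n} {s : LocalState n M}
    {a : AppMsg n M} {pos : ℕ} (h : (react t e i s).2[pos]? = some (.deliver a)) :
    pos + 1 = (react t e i s).2.length ∧
      ¬ s.HasDelivered a.sn a.sender ∧ a ∈ (react t e i s).1.delivered ∧
      (react t e i s).1.HasQuorum t a ∧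
      (∃ b, e.Receives i b ∧ b.app = a ∧ (⟨a.sender, a⟩ : Signature n M) ∈ b.sigs) ∧
      ∃ pos' : ℕ, (react t e i s).2[pos']? =
        some (.broadcast ⟨a, (react t e i s).1.sigsFor a⟩) := by
  rcases react_cases t e i s with hr | ⟨m, sn, -, hr⟩ | ⟨b, hb, hd, hs, hr⟩ <;> rw [hr] at h ⊢
  · simp at h
  · simp [onInvoke, List.getElem?_singleton] at h
  · rcases deliverPhase_outputs t b.app (afterForward i b s) with ⟨hq, ho⟩ | ⟨hq, ho⟩
    -- The forwarding phase contributes no output or one broadcast; the delivery phase contributes a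
    -- broadcast and then the delivery, which is therefore the last output.
    · have hpos : pos = (forwardPhase i b.app (s.saveValid b)).2.length + 1 ∧ a = b.app := by
        rcases forwardPhase_outputs i b s with ⟨-, hf⟩ | ⟨-, hf⟩ <;>
        · simp only [ho, hf] at h ⊢
          rcases pos with _ | _ | _ | pos <;> simp_all
      obtain ⟨rfl, rfl⟩ := hpos
      refine ⟨by simp [ho], hd, ?_, ?_, ⟨b, hb, rfl, hs⟩,
        (forwardPhase i b.app (s.saveValid b)).2.length, ?_⟩
      · exact mem_deliverPhase_delivered.2 (.inr ⟨rfl, hq⟩)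
      · simpa [LocalState.HasQuorum, deliverPhase_sigsFor] using hq
      · simp [ho, deliverPhase_sigsFor]
    · rcases forwardPhase_outputs i b s with ⟨-, hf⟩ | ⟨-, hf⟩ <;>
      · simp only [ho, hf] at h
        rcases pos with _ | pos <;> simp at h

/-- The shape of a reaction with a broadcast. -/
theorem react_broadcast {t : ℕ} {e : Event n M} {i : Fin n} {s : LocalState n M}
    {b : Bundle n M} {pos : ℕ} (h : (react t e i s).2[pos]? = some (.broadcast b)) :
    b.sigs = (react t e i s).1.sigsFor b.app ∧
      (⟨b.app.sender, b.app⟩ : Signature n M) ∈ b.sigs ∧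
      (pos = 0 ∧ b.app ∈ (react t e i s).1.signed ∧
          (e = .invoke i b.app.content b.app.sn ∧ b.app.sender = i ∨
            ¬ s.HasSigned b.app.sn b.app.sender) ∨
        (react t e i s).2[pos + 1]? = some (.deliver b.app)) := by
  rcases react_cases t e i s with hr | ⟨m, sn, he, hr⟩ | ⟨b', hb, hd, hs, hr⟩ <;> rw [hr] at h ⊢
  · simp at h
  · rcases pos with _ | pos
    · simp only [onInvoke, List.getElem?_cons_zero, Option.some.injEq, Output.broadcast.injEq] at h
      subst h
      refine ⟨rfl, by simp [LocalState.mem_sigsFor, LocalState.sign],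
        .inl ⟨rfl, by simp [onInvoke, LocalState.sign], .inl ⟨he, rfl⟩⟩⟩
    · simp [onInvoke] at h
  · have hmem : (⟨b'.app.sender, b'.app⟩ : Signature n M) ∈
        (afterForward i b' s).sigsFor b'.app := by
      simp [LocalState.mem_sigsFor, mem_afterForward_saved, hs]
    -- The delivery phase changes neither `saved` nor `signed`, so both possible broadcasts carry
    -- exactly the signatures saved at the end of the step.
    rcases deliverPhase_outputs t b'.app (afterForward i b' s) with ⟨hq, ho⟩ | ⟨hq, ho⟩ <;>
    rcases forwardPhase_outputs i b' s with ⟨hn, hf⟩ | ⟨hn, hf⟩ <;>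
    simp only [ho, hf, deliverPhase_sigsFor, deliverPhase_signed] at h ⊢ <;>
    rcases pos with _ | _ | _ | pos <;> simp at h <;> subst h <;>
    simp [hmem, mem_afterForward_signed, hn]

/-- The effect of the reception of a bundle with the signature of the sender. -/
theorem react_receives {t : ℕ} {e : Event n M} {i : Fin n} {b : Bundle n M}
    (h : e.Receives i b) (hs : (⟨b.app.sender, b.app⟩ : Signature n M) ∈ b.sigs)
    (s : LocalState n M) :
    s.HasDelivered b.app.sn b.app.sender ∨
      ((∀ σ ∈ b.sigs, σ.signed = b.app → σ ∈ (react t e i s).1.saved) ∧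
        (react t e i s).1.HasSigned b.app.sn b.app.sender ∧
        ((react t e i s).1.HasQuorum t b.app → b.app ∈ (react t e i s).1.delivered)) := by
  by_cases hd : s.HasDelivered b.app.sn b.app.sender
  · exact .inl hd
  right
  have hr : (react t e i s).1 = (deliverPhase t b.app (afterForward i b s)).1 := by
    rw [react_of_receives h, onReceive, if_pos ⟨hd, hs⟩]
    rfl
  rw [hr]
  refine ⟨fun σ hσ hσ' => ?_, ?_, fun hq => ?_⟩
  · simp [deliverPhase_saved, mem_afterForward_saved, hσ, hσ']
  · unfold LocalState.HasSigned
    simp only [deliverPhase_signed, mem_afterForward_signed]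
    by_cases hn : s.HasSigned b.app.sn b.app.sender
    · obtain ⟨a, ha, ha'⟩ := hn
      exact ⟨a, .inl ha, ha'⟩
    · exact ⟨b.app, .inr ⟨hn, rfl⟩, rfl, rfl⟩
  · rw [mem_deliverPhase_delivered]
    refine .inr ⟨rfl, ?_⟩
    simpa [LocalState.HasQuorum, deliverPhase_sigsFor] using hq

end Local

end MBRB

/-! ### Invariants of executions and quorum intersection -/

namespace MBRB

/-- A signature of a fixed triplet is determined by its signer; this turns quorums of signatures
into sets of participants. -/
theorem card_signers_sigsFor {n : ℕ} {M : Type*} (s : LocalState n M) (a : AppMsg n M) :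
    ((s.sigsFor a).image Signature.signer).card = (s.sigsFor a).card := by
  apply Finset.card_image_of_injOn
  intro σ hσ σ' hσ' h
  have h₁ := (LocalState.mem_sigsFor.1 hσ).2
  have h₂ := (LocalState.mem_sigsFor.1 hσ').2
  exact Signature.ext h (h₁.trans h₂.symm)

namespace Execution

variable {n t d : ℕ} {M : Type*} (E : Execution n t d M)

/-- The local state of `p_i` just before step `k`. -/
noncomputable def state (k : ℕ) (i : Fin n) : LocalState n M := stateAt t E.event k i

theorem state_zero (i : Fin n) : E.state 0 i = LocalState.init := rfl

theorem outputAt_eq (κ : OutputId n) : outputAt t E.event κ =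
    (react t (E.event κ.step) κ.proc (E.state κ.step κ.proc)).2[κ.pos]? := rfl

theorem saved_mono (i : Fin n) : Monotone fun k => (E.state k i).saved :=
  monotone_nat_of_le_succ fun _ => react_saved_subset _ _ _ _

theorem signed_mono (i : Fin n) : Monotone fun k => (E.state k i).signed :=
  monotone_nat_of_le_succ fun _ => react_signed_subset _ _ _ _

theorem delivered_mono (i : Fin n) : Monotone fun k => (E.state k i).delivered :=
  monotone_nat_of_le_succ fun _ => react_delivered_subset _ _ _ _

theorem hasSigned_mono {i : Fin n} {k k' : ℕ} (h : k ≤ k') {sn : ℕ} {j : Fin n}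
    (hs : (E.state k i).HasSigned sn j) : (E.state k' i).HasSigned sn j := by
  obtain ⟨a, ha, h'⟩ := hs
  exact ⟨a, E.signed_mono i h ha, h'⟩

theorem hasDelivered_mono {i : Fin n} {k k' : ℕ} (h : k ≤ k') {sn : ℕ} {j : Fin n}
    (hs : (E.state k i).HasDelivered sn j) : (E.state k' i).HasDelivered sn j := by
  obtain ⟨a, ha, h'⟩ := hs
  exact ⟨a, E.delivered_mono i h ha, h'⟩

/-- The saved signatures of correct participants were produced by them. -/
theorem signed_of_mem_saved {k : ℕ} {i : Fin n} {σ : Signature n M}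
    (hσ : σ ∈ (E.state k i).saved) (hc : σ.signer ∈ E.correct) :
    σ.signed ∈ (E.state k σ.signer).signed := by
  induction k generalizing i with
  | zero => simp [state_zero, LocalState.init] at hσ
  | succ k ih =>
    have hle := E.signed_mono σ.signer (Nat.le_succ k)
    rcases mem_react_saved hσ with h | ⟨rfl, h⟩ | ⟨b, ⟨κ, hb⟩ | ⟨src, hb⟩, h⟩
    · exact hle (ih h)
    · exact h
    -- The signatures in a bundle from a correct participant were saved there at an earlier step, so
    -- the induction hypothesis is applied to that participant.
    · obtain ⟨-, -, hlt, ho⟩ := E.receive_sent _ _ _ _ hb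
      rw [E.outputAt_eq] at ho
      have hm := h
      rw [(react_broadcast ho).1, LocalState.mem_sigsFor] at hm
      exact hle (ih (E.saved_mono κ.proc (Nat.succ_le_of_lt hlt) hm.1))
    · exact hle ((E.receiveByz_unforged _ _ _ _ hb).2.2 σ h hc)

/-- Signatures in transit are as trustworthy as saved ones: a correct source sends only what it has
saved, and a Byzantine source cannot forge. -/
theorem signed_of_receives {k : ℕ} {i : Fin n} {b : Bundle n M} {σ : Signature n M}
    (h : (E.event k).Receives i b) (hσ : σ ∈ b.sigs) (hc : σ.signer ∈ E.correct) :
    σ.signed ∈ (E.state k σ.signer).signed := by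
  rcases h with ⟨κ, hb⟩ | ⟨src, hb⟩
  · obtain ⟨-, -, hlt, ho⟩ := E.receive_sent _ _ _ _ hb
    rw [E.outputAt_eq] at ho
    rw [(react_broadcast ho).1, LocalState.mem_sigsFor] at hσ
    exact E.signed_of_mem_saved (E.saved_mono κ.proc (Nat.succ_le_of_lt hlt) hσ.1) hc
  · exact (E.receiveByz_unforged _ _ _ _ hb).2.2 σ hσ hc

/-- Triplets of a correct sender are signed only after the mbrb-broadcast. -/
theorem invoked_of_signed {k : ℕ} {i : Fin n} {a : AppMsg n M}
    (ha : a ∈ (E.state k i).signed) (hc : a.sender ∈ E.correct) :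
    ∃ k' < k, E.event k' = .invoke a.sender a.content a.sn := by
  induction k generalizing i with
  | zero => simp [state_zero, LocalState.init] at ha
  | succ k ih =>
    have hlift : (∃ k' < k, E.event k' = .invoke a.sender a.content a.sn) →
        ∃ k' < k + 1, E.event k' = .invoke a.sender a.content a.sn :=
      fun ⟨k', h, h'⟩ => ⟨k', h.trans k.lt_succ_self, h'⟩
    rcases mem_react_signed ha with h | ⟨⟨h, rfl⟩ | ⟨-, b, hb, rfl, h⟩, -⟩
    · exact hlift (ih h)
    · exact ⟨k, k.lt_succ_self, h⟩
    -- An accepted bundle shows that the sender itself has signed; the induction continues with the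
    -- sender in place of `i`.
    · exact hlift (ih (E.signed_of_receives hb h hc))

/-- A participant signs at most one triplet `(-, sn, j)`. -/
theorem signed_unique {k : ℕ} {i : Fin n} {a a' : AppMsg n M}
    (ha : a ∈ (E.state k i).signed) (ha' : a' ∈ (E.state k i).signed)
    (hsn : a.sn = a'.sn) (hj : a.sender = a'.sender) : a = a' := by
  induction k with
  | zero => simp [state_zero, LocalState.init] at ha
  | succ k ih =>
    -- An invocation does not test for earlier signatures. One with the same identity would
    -- presuppose an earlier invocation with the same sequence number, against `invoke_once`.
    have mixed : ∀ a a' : AppMsg n M, a ∈ (E.state k i).signed → a.sn = a'.sn →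
        a.sender = a'.sender → (E.event k = .invoke i a'.content a'.sn ∧ a'.sender = i ∨
        ¬ (E.state k i).HasSigned a'.sn a'.sender ∧ ∃ b, (E.event k).Receives i b ∧ b.app = a' ∧
          (⟨a'.sender, a'⟩ : Signature n M) ∈ b.sigs) → False := by
      rintro a a' ha hsn hj (⟨he, rfl⟩ | ⟨hn, -⟩)
      · have hc := E.invoke_correct _ _ _ _ he
        obtain ⟨k', hk', he'⟩ := E.invoked_of_signed ha (hj ▸ hc)
        rw [hj, hsn] at he'
        exact hk'.ne (E.invoke_once _ _ _ _ _ _ he' he)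
      · exact hn ⟨a, ha, hsn, hj⟩
    rcases mem_react_signed ha with h | ⟨h, -⟩ <;>
    rcases mem_react_signed ha' with h' | ⟨h', -⟩
    · exact ih h h'
    · exact (mixed _ _ h hsn hj h').elim
    · exact (mixed _ _ h' hsn.symm hj.symm h).elim
    · rcases h with ⟨h, hs⟩ | ⟨-, b, hb, rfl, -⟩ <;>
      rcases h' with ⟨h', hs'⟩ | ⟨-, b', hb', rfl, -⟩
      · rw [h] at h'
        injection h' with _ h₁ _
        exact AppMsg.ext h₁ hsn hj
      · rw [h] at hb'
        simp [Event.Receives] at hb'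
      · rw [h'] at hb
        simp [Event.Receives] at hb
      · rcases hb with ⟨_, hb⟩ | ⟨_, hb⟩ <;> rcases hb' with ⟨_, hb'⟩ | ⟨_, hb'⟩ <;>
          rw [hb] at hb' <;> simp_all

/-- Two quorums for the same identity are quorums for the same triplet. -/
theorem quorum_unique {k k' : ℕ} {i i' : Fin n} {a a' : AppMsg n M}
    (h : (E.state k i).HasQuorum t a) (h' : (E.state k' i').HasQuorum t a')
    (hsn : a.sn = a'.sn) (hj : a.sender = a'.sender) : a = a' := by
  classical
  set Q := ((E.state k i).sigsFor a).image Signature.signer with hQ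
  set Q' := ((E.state k' i').sigsFor a').image Signature.signer with hQ'
  have hc : (Q ∪ Q').card + (Q ∩ Q').card = Q.card + Q'.card :=
    Finset.card_union_add_card_inter Q Q'
  have hn : (Q ∪ Q').card ≤ n := by simpa using Finset.card_le_univ (Q ∪ Q')
  have hcard : Q.card = _ := card_signers_sigsFor _ _
  have hcard' : Q'.card = _ := card_signers_sigsFor _ _
  unfold LocalState.HasQuorum at h h'
  -- The intersection has at least t+1 elements, and at most t participants are Byzantine.
  have hint : n < (Q ∩ Q').card + E.correct.card := by
    have := E.card_correct
    omega
  have hne : ((Q ∩ Q') ∩ E.correct).Nonempty := by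
    rw [← Finset.card_pos]
    have h₁ := Finset.card_union_add_card_inter (Q ∩ Q') E.correct
    have h₂ : ((Q ∩ Q') ∪ E.correct).card ≤ n := by
      simpa using Finset.card_le_univ ((Q ∩ Q') ∪ E.correct)
    omega
  obtain ⟨p, hp⟩ := hne
  simp only [Finset.mem_inter, hQ, hQ', Finset.mem_image, LocalState.mem_sigsFor] at hp
  obtain ⟨⟨⟨σ, ⟨hσ, rfl⟩, rfl⟩, σ', ⟨hσ', rfl⟩, hp⟩, hpc⟩ := hp
  have h₁ := E.signed_of_mem_saved hσ hpc
  have h₂ := E.signed_of_mem_saved hσ' (hp ▸ hpc)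
  rw [hp] at h₂
  exact E.signed_unique (E.signed_mono _ (le_max_left k k') h₁)
    (E.signed_mono _ (le_max_right k k') h₂) hsn hj

/-! ### Deliveries and signatures located among the steps -/

/-- The participant `p` mbrb-delivers `a` at a step with `Q`. -/
def DeliversDuring (Q : ℕ → Prop) (p : Fin n) (a : AppMsg n M) : Prop :=
  ∃ κ : OutputId n, κ.proc = p ∧ E.DeliversAt κ a ∧ Q κ.step

/-- The participant `p` broadcasts at a step with `Q` a bundle for `a` with its own signature. -/
def SignsDuring (Q : ℕ → Prop) (p : Fin n) (a : AppMsg n M) : Prop :=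
  ∃ (κ : OutputId n) (S : Finset (Signature n M)), κ.proc = p ∧
    outputAt t E.event κ = some (.broadcast ⟨a, S⟩) ∧ ⟨p, a⟩ ∈ S ∧ Q κ.step

theorem deliversDuring_of_mem {k : ℕ} {i : Fin n} {a : AppMsg n M}
    (ha : a ∈ (E.state k i).delivered) : E.DeliversDuring (· < k) i a := by
  induction k with
  | zero => simp [state_zero, LocalState.init] at ha
  | succ k ih =>
    rcases mem_react_delivered ha with h | ⟨pos, h⟩
    · obtain ⟨κ, h₁, h₂, h₃⟩ := ih h
      exact ⟨κ, h₁, h₂, h₃.trans k.lt_succ_self⟩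
    · exact ⟨⟨i, k, pos⟩, rfl, h, k.lt_succ_self⟩

theorem signsDuring_of_mem {k : ℕ} {i : Fin n} {a : AppMsg n M}
    (ha : a ∈ (E.state k i).signed) : E.SignsDuring (· < k) i a := by
  induction k with
  | zero => simp [state_zero, LocalState.init] at ha
  | succ k ih =>
    rcases mem_react_signed ha with h | ⟨-, S, hS, h⟩
    · obtain ⟨κ, S, h₁, h₂, h₃, h₄⟩ := ih h
      exact ⟨κ, S, h₁, h₂, h₃, h₄.trans k.lt_succ_self⟩
    · exact ⟨⟨i, k, 0⟩, S, rfl, h, hS, k.lt_succ_self⟩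

theorem deliversAt_spec {κ : OutputId n} {a : AppMsg n M} (h : E.DeliversAt κ a) :
    κ.pos + 1 = (react t (E.event κ.step) κ.proc (E.state κ.step κ.proc)).2.length ∧
      ¬ (E.state κ.step κ.proc).HasDelivered a.sn a.sender ∧
      a ∈ (E.state (κ.step + 1) κ.proc).delivered ∧
      (E.state (κ.step + 1) κ.proc).HasQuorum t a ∧
      (∃ b, (E.event κ.step).Receives κ.proc b ∧ b.app = a ∧
        (⟨a.sender, a⟩ : Signature n M) ∈ b.sigs) ∧
      ∃ pos' : ℕ, outputAt t E.event ⟨κ.proc, κ.step, pos'⟩ =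
        some (.broadcast ⟨a, (E.state (κ.step + 1) κ.proc).sigsFor a⟩) :=
  react_deliver h

/-- A delivery requires that the identity is undelivered and then records it, so the step is unique.
-/
theorem delivery_unique {κ κ' : OutputId n} {a a' : AppMsg n M} (hp : κ.proc = κ'.proc)
    (h : E.DeliversAt κ a) (h' : E.DeliversAt κ' a') (hsn : a.sn = a'.sn)
    (hj : a.sender = a'.sender) : κ = κ' := by
  obtain ⟨h₁, h₂, h₃, -⟩ := E.deliversAt_spec h
  obtain ⟨h₁', h₂', h₃', -⟩ := E.deliversAt_spec h'
  have hstep : κ.step = κ'.step := by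
    rcases lt_trichotomy κ.step κ'.step with hlt | heq | hlt
    · rw [← hp] at h₂'
      exact (h₂' ⟨a, E.delivered_mono _ (Nat.succ_le_of_lt hlt) h₃, hsn, hj⟩).elim
    · exact heq
    · rw [hp] at h₂
      exact (h₂ ⟨a', E.delivered_mono _ (Nat.succ_le_of_lt hlt) h₃', hsn.symm, hj.symm⟩).elim
  -- Within a step the delivery is the last output, which fixes its position.
  rw [hp, hstep] at h₁
  exact OutputId.ext hp hstep (by omega)

theorem Delivers.unique {E : Execution n t d M} {i i' : Fin n} {a a' : AppMsg n M}
    (h : E.Delivers i a) (h' : E.Delivers i' a') (hsn : a.sn = a'.sn)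
    (hj : a.sender = a'.sender) : a = a' := by
  obtain ⟨κ, -, h⟩ := h
  obtain ⟨κ', -, h'⟩ := h'
  exact E.quorum_unique (E.deliversAt_spec h).2.2.2.1 (E.deliversAt_spec h').2.2.2.1 hsn hj

theorem DeliversDuring.delivers {E : Execution n t d M} {Q : ℕ → Prop} {i : Fin n}
    {a : AppMsg n M} (h : E.DeliversDuring Q i a) : E.Delivers i a := by
  obtain ⟨κ, h₁, h₂, -⟩ := h
  exact ⟨κ, h₁, h₂⟩

theorem invoked_of_deliversAt {κ : OutputId n} {a : AppMsg n M} (hc : a.sender ∈ E.correct)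
    (h : E.DeliversAt κ a) : ∃ k < κ.step, E.event k = .invoke a.sender a.content a.sn := by
  obtain ⟨b, hb, -, hs⟩ := (E.deliversAt_spec h).2.2.2.2.1
  exact E.invoked_of_signed (E.signed_of_receives hb hs hc) hc

/-- Triplets signed with the identity of an invocation are those of the invocation. -/
theorem signed_eq_of_invoke {k k' : ℕ} {i p : Fin n} {m : M} {sn : ℕ} {a : AppMsg n M}
    (he : E.event k = .invoke i m sn) (ha : a ∈ (E.state k' p).signed) (hsn : a.sn = sn)
    (hj : a.sender = i) : k < k' ∧ a = ⟨m, sn, i⟩ := by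
  subst hsn hj
  obtain ⟨k₁, hk₁, he₁⟩ := E.invoked_of_signed ha (E.invoke_correct _ _ _ _ he)
  obtain rfl := E.invoke_once _ _ _ _ _ _ he he₁
  rw [he] at he₁
  injection he₁ with _ h _
  exact ⟨hk₁, AppMsg.ext h.symm rfl rfl⟩

theorem delivered_eq_of_invoke {k k' : ℕ} {i p : Fin n} {m : M} {sn : ℕ} {a : AppMsg n M}
    (he : E.event k = .invoke i m sn) (ha : a ∈ (E.state k' p).delivered) (hsn : a.sn = sn)
    (hj : a.sender = i) : a = ⟨m, sn, i⟩ := by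
  subst hsn hj
  have hc := E.invoke_correct _ _ _ _ he
  obtain ⟨κ, -, hκ, -⟩ := E.deliversDuring_of_mem ha
  obtain ⟨k₁, -, he₁⟩ := E.invoked_of_deliversAt hc hκ
  obtain rfl := E.invoke_once _ _ _ _ _ _ he he₁
  rw [he] at he₁
  injection he₁ with _ h _
  exact AppMsg.ext h.symm rfl rfl

/-- Whoever delivered an identity has signed it. -/
theorem hasSigned_of_hasDelivered {k : ℕ} {i : Fin n} {sn : ℕ} {j : Fin n}
    (h : (E.state k i).HasDelivered sn j) : (E.state k i).HasSigned sn j := by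
  obtain ⟨a, ha, rfl, rfl⟩ := h
  obtain ⟨κ, rfl, hκ, hlt⟩ := E.deliversDuring_of_mem ha
  obtain ⟨-, hd, -, -, ⟨b, hb, rfl, hs⟩, -⟩ := E.deliversAt_spec hκ
  rcases react_receives (t := t) hb hs (E.state κ.step κ.proc) with h | ⟨-, h, -⟩
  · exact (hd h).elim
  · exact E.hasSigned_mono (Nat.succ_le_of_lt hlt) h

/-! ### Message cost -/

theorem messageCostLE : E.MessageCostLE (2 * n ^ 2) := by
  classical
  intro k i m sn hi he
  set T := {p : OutputId n × Fin n | p.1.proc ∈ E.correct ∧ ∃ b : Bundle n M,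
      outputAt t E.event p.1 = some (.broadcast b) ∧ b.app.sn = sn ∧ b.app.sender = i}
  -- The Boolean in `f` separates the broadcast directly followed by a delivery from the one that
  -- accompanies signing. Each occurs at most once per participant, whence the factor 2.
  let IsDel : OutputId n → Prop := fun κ =>
    ∃ a, E.DeliversAt ⟨κ.proc, κ.step, κ.pos + 1⟩ a ∧ a.sn = sn ∧ a.sender = i
  let f : OutputId n × Fin n → Fin n × Fin n × Bool :=
    fun p => (p.1.proc, p.2, decide (IsDel p.1))
  -- The other broadcast is the first output of the step at which the identity passes from unsigned
  -- to signed, and there is only one such step.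
  have hnot : ∀ p ∈ T, ¬ IsDel p.1 → p.1.pos = 0 ∧
      (E.state (p.1.step + 1) p.1.proc).HasSigned sn i ∧
        ¬ (E.state p.1.step p.1.proc).HasSigned sn i := by
    rintro ⟨κ, q⟩ ⟨-, b, hb, rfl, rfl⟩ hnd
    rcases (react_broadcast hb).2.2 with ⟨h₁, h₂, h₃⟩ | h
    · refine ⟨h₁, ⟨_, h₂, rfl, rfl⟩, ?_⟩
      rcases h₃ with ⟨h₃, hp⟩ | h₃
      · rintro ⟨a, ha, hsn, hj⟩
        exact (E.signed_eq_of_invoke h₃ ha hsn (hj.trans hp)).1.false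
      · exact h₃
    · exact (hnd ⟨_, h, rfl, rfl⟩).elim
  have hinj : Set.InjOn f T := by
    rintro ⟨κ, q⟩ hp ⟨κ', q'⟩ hp' hf
    simp only [f, Prod.mk.injEq, decide_eq_decide] at hf
    obtain ⟨hproc, rfl, hiff⟩ := hf
    suffices κ = κ' by rw [this]
    by_cases hd : IsDel κ
    · obtain ⟨a', ha', hsn', hj'⟩ := hiff.1 hd
      obtain ⟨a, ha, hsn, hj⟩ := hd
      have := E.delivery_unique (κ := ⟨κ.proc, κ.step, κ.pos + 1⟩)
        (κ' := ⟨κ'.proc, κ'.step, κ'.pos + 1⟩) hproc ha ha' (hsn.trans hsn'.symm) (hj.trans hj'.symm)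
      simp only [OutputId.mk.injEq, Nat.add_right_cancel_iff] at this
      exact OutputId.ext this.1 this.2.1 this.2.2
    · obtain ⟨h₁, h₂, h₃⟩ := hnot _ hp hd
      obtain ⟨h₁', h₂', h₃'⟩ := hnot _ hp' (fun h => hd (hiff.2 h))
      dsimp only at *
      refine OutputId.ext hproc ?_ (h₁.trans h₁'.symm)
      rcases lt_trichotomy κ.step κ'.step with hlt | heq | hlt
      · rw [← hproc] at h₃'
        exact (h₃' (E.hasSigned_mono (Nat.succ_le_of_lt hlt) h₂)).elim
      · exact heq
      · rw [hproc] at h₃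
        exact (h₃ (E.hasSigned_mono (Nat.succ_le_of_lt hlt) h₂')).elim
  rw [← hinj.encard_image]
  refine (Set.encard_le_encard (Set.subset_univ _)).trans ?_
  rw [Set.encard_univ, ENat.card_eq_coe_fintype_card]
  simp only [Fintype.card_prod, Fintype.card_fin, Fintype.card_bool]
  apply le_of_eq
  norm_cast
  ring

end Execution

end MBRB

namespace MBRB

/-! ### Double counting -/

section Counting

variable {α : Type*} [DecidableEq α]

/-- Otherwise the incidences, at least |A|·m, would number at most F·|B|. -/
theorem exists_many_of_card_lt {A B : Finset α} {R : α → Finset α} {m F : ℕ}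
    (hR : ∀ p ∈ A, R p ⊆ B) (hm : ∀ p ∈ A, m ≤ (R p).card) (h : F * B.card < A.card * m) :
    ∃ j ∈ B, F < (A.filter fun p => j ∈ R p).card := by
  by_contra! hcon
  have hdc := Finset.sum_card_bipartiteAbove_eq_sum_card_bipartiteBelow
    (s := A) (t := B) (fun p j => j ∈ R p)
  have h₁ : A.card * m ≤ ∑ p ∈ A, (B.filter fun j => j ∈ R p).card := by
    rw [← smul_eq_mul]
    apply Finset.card_nsmul_le_sum
    intro p hp
    rw [Finset.filter_mem_eq_inter, Finset.inter_eq_right.2 (hR p hp)]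
    exact hm p hp
  have h₂ : ∑ j ∈ B, (A.filter fun p => j ∈ R p).card ≤ B.card * F := by
    rw [← smul_eq_mul]
    exact Finset.sum_le_card_nsmul _ _ _ hcon
  simp only [Finset.bipartiteAbove, Finset.bipartiteBelow] at hdc
  rw [mul_comm F] at h
  omega

/-- An element lying in at most F of the sets is missed by at least |A|-F of them. If d+1 elements
were so, comparison with the at most d|A| misses in all would give |A| ≤ (d+1)F. -/
theorem card_le_card_filter_add {A C : Finset α} {R : α → Finset α} {d F : ℕ}
    (hd : ∀ p ∈ A, (C.filter fun j => j ∉ R p).card ≤ d) (h : (d + 1) * F < A.card) :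
    C.card ≤ (C.filter fun j => F < (A.filter fun p => j ∈ R p).card).card + d := by
  by_contra! hcon
  set X := C.filter fun j => ¬ F < (A.filter fun p => j ∈ R p).card with hX
  have hXc : d + 1 ≤ X.card := by
    have : (C.filter fun j => F < (A.filter fun p => j ∈ R p).card).card + X.card = C.card :=
      Finset.card_filter_add_card_filter_not _
    omega
  have hdc := Finset.sum_card_bipartiteAbove_eq_sum_card_bipartiteBelow
    (s := A) (t := X) (fun p j => j ∉ R p)
  simp only [Finset.bipartiteAbove, Finset.bipartiteBelow] at hdc
  have h₁ : ∑ p ∈ A, (X.filter fun j => j ∉ R p).card ≤ A.card * d := by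
    rw [← smul_eq_mul]
    apply Finset.sum_le_card_nsmul
    intro p hp
    exact (Finset.card_le_card
      (Finset.filter_subset_filter _ (Finset.filter_subset _ _))).trans (hd p hp)
  have h₂ : X.card * (A.card - F) ≤ ∑ j ∈ X, (A.filter fun p => j ∉ R p).card := by
    rw [← smul_eq_mul]
    apply Finset.card_nsmul_le_sum
    intro j hj
    have h₃ := (Finset.mem_filter.1 hj).2
    have h₄ := Finset.card_filter_add_card_filter_not (s := A) (fun p => j ∈ R p)
    omega
  have h₅ : (d + 1) * (A.card - F) ≤ A.card * d :=
    (Nat.mul_le_mul_right _ hXc).trans (h₂.trans (hdc ▸ h₁))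
  rw [Nat.mul_sub, add_mul] at h₅
  have := mul_comm d A.card
  omega

end Counting

/-! ### Rounds of communication -/

namespace Execution

variable {n t d : ℕ} {M : Type*} (E : Execution n t d M)

/-- `Q` holds for an initial segment of the steps, to which all receptions of bundles belong that
correct participants send at steps with `P`. -/
structure Transfers (P Q : ℕ → Prop) : Prop where
  antitone : ∀ k k', k ≤ k' → Q k' → Q k
  receive : ∀ k i b κ, E.event k = .receive i b κ → P κ.step → Q k

/-- With this choice the lemmas on rounds yield the untimed guarantees; with `IsTiming.transfers`
the same lemmas yield the time bounds. -/
theorem transfers_true : E.Transfers (fun _ => True) (fun _ => True) :=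
  ⟨fun _ _ _ _ => trivial, fun _ _ _ _ _ _ => trivial⟩

theorem IsTiming.transfers {E : Execution n t d M} {δ : ℝ} {time : ℕ → ℝ}
    (h : E.IsTiming δ time) (x : ℝ) :
    E.Transfers (fun k => time k ≤ x) (fun k => time k ≤ x + δ) where
  antitone _ _ hk hx := (h.mono hk).trans hx
  receive k i b κ he hx := by
    rw [h.delay k i b κ he]
    linarith

theorem DeliversDuring.mono {E : Execution n t d M} {P Q : ℕ → Prop} {p : Fin n}
    {a : AppMsg n M} (h : E.DeliversDuring P p a) (hPQ : ∀ k, P k → Q k) :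
    E.DeliversDuring Q p a := by
  obtain ⟨κ, h₁, h₂, h₃⟩ := h
  exact ⟨κ, h₁, h₂, hPQ _ h₃⟩

theorem SignsDuring.mono {E : Execution n t d M} {P Q : ℕ → Prop} {p : Fin n}
    {a : AppMsg n M} (h : E.SignsDuring P p a) (hPQ : ∀ k, P k → Q k) :
    E.SignsDuring Q p a := by
  obtain ⟨κ, S, h₁, h₂, h₃, h₄⟩ := h
  exact ⟨κ, S, h₁, h₂, h₃, hPQ _ h₄⟩

theorem signsDuring_invoke {k : ℕ} {i : Fin n} {m : M} {sn : ℕ}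
    (he : E.event k = .invoke i m sn) : E.SignsDuring (· ≤ k) i ⟨m, sn, i⟩ := by
  refine ⟨⟨i, k, 0⟩, ((E.state k i).sign i ⟨m, sn, i⟩).sigsFor ⟨m, sn, i⟩, rfl, ?_, ?_, le_rfl⟩
  · simp [outputAt_eq, he, react, onInvoke]
  · simp [LocalState.mem_sigsFor, LocalState.sign]

theorem sender_mem_of_broadcast {κ : OutputId n} {b : Bundle n M}
    (h : outputAt t E.event κ = some (.broadcast b)) :
    (⟨b.app.sender, b.app⟩ : Signature n M) ∈ b.sigs :=
  (react_broadcast h).2.1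

open Classical in
/-- The correct participants that receive the bundle `b` broadcast as the output `κ`. -/
noncomputable def receivers (κ : OutputId n) (b : Bundle n M) : Finset (Fin n) :=
  E.correct.filter fun j => ∃ k, E.event k = .receive j b κ

theorem mem_receivers {κ : OutputId n} {b : Bundle n M} {j : Fin n} :
    j ∈ E.receivers κ b ↔ j ∈ E.correct ∧ ∃ k, E.event k = .receive j b κ := by
  simp [receivers]

theorem card_filter_notMem_receivers {κ : OutputId n} {b : Bundle n M} (hc : κ.proc ∈ E.correct)
    (h : outputAt t E.event κ = some (.broadcast b)) :
    (E.correct.filter fun j => j ∉ E.receivers κ b).card ≤ d := by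
  classical
  refine (Finset.card_le_card fun j hj => ?_).trans (E.adversary κ b hc h)
  simp only [Finset.mem_filter, mem_receivers, not_and] at hj ⊢
  exact ⟨hj.1, hj.2 hj.1⟩

theorem c_le_card_receivers {κ : OutputId n} {b : Bundle n M} (hc : κ.proc ∈ E.correct)
    (h : outputAt t E.event κ = some (.broadcast b)) :
    E.c - d ≤ (E.receivers κ b).card := by
  classical
  have h₁ := E.card_filter_notMem_receivers hc h
  have h₂ := Finset.card_filter_add_card_filter_not
    (s := E.correct) (fun j => j ∈ E.receivers κ b)
  rw [Finset.filter_mem_eq_inter,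
    Finset.inter_eq_right.2 fun j hj => (E.mem_receivers.1 hj).1] at h₂
  unfold c
  omega

/-- A bundle with a quorum makes its receivers deliver. -/
theorem deliversDuring_of_receive_quorum {k₀ k : ℕ} {i j : Fin n} {κ : OutputId n}
    {a : AppMsg n M} {S : Finset (Signature n M)} (hdel : (E.state k₀ i).HasQuorum t a)
    (hS : S = (E.state k₀ i).sigsFor a) (ho : outputAt t E.event κ = some (.broadcast ⟨a, S⟩))
    (he : E.event k = .receive j ⟨a, S⟩ κ) : E.DeliversDuring (· ≤ k) j a := by
  have hd : (E.state (k + 1) j).HasDelivered a.sn a.sender := by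
    rcases react_receives (t := t) (.inl ⟨κ, he⟩) (E.sender_mem_of_broadcast ho) (E.state k j)
      with h | ⟨h₁, -, h₂⟩
    · exact E.hasDelivered_mono k.le_succ h
    · refine ⟨a, h₂ ?_, rfl, rfl⟩
      have hsub : S ⊆ (E.state (k + 1) j).sigsFor a := by
        intro σ hσ
        have hσ' : σ.signed = a := (LocalState.mem_sigsFor.1 (hS ▸ hσ)).2
        exact LocalState.mem_sigsFor.2 ⟨h₁ σ hσ hσ', hσ'⟩
      have := Finset.card_le_card hsub
      change n + t < 2 * ((E.state (k + 1) j).sigsFor a).card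
      unfold LocalState.HasQuorum at hdel
      rw [← hS] at hdel
      omega
  obtain ⟨a', ha', hsn, hj⟩ := hd
  have hdd := E.deliversDuring_of_mem ha'
  obtain ⟨κ', -, hκ', -⟩ := id hdd
  -- The receiver may have delivered the identity earlier, rejecting the bundle; quorum intersection
  -- shows that it was the same triplet.
  obtain rfl := E.quorum_unique hdel (E.deliversAt_spec hκ').2.2.2.1 hsn.symm hj.symm
  exact hdd.mono fun _ => Nat.le_of_lt_succ

open Classical in
theorem DeliversDuring.global {E : Execution n t d M} {P Q : ℕ → Prop} (hT : E.Transfers P Q)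
    {i : Fin n} {a : AppMsg n M} (hi : i ∈ E.correct) (h : E.DeliversDuring P i a) :
    E.c - d ≤ (E.correct.filter fun j => E.DeliversDuring Q j a).card := by
  obtain ⟨κ, rfl, hκ, hP⟩ := h
  obtain ⟨-, -, -, hq, -, pos', ho⟩ := E.deliversAt_spec hκ
  refine (E.c_le_card_receivers (κ := ⟨κ.proc, κ.step, pos'⟩) hi ho).trans
    (Finset.card_le_card fun j hj => ?_)
  rw [mem_receivers] at hj
  obtain ⟨hj, k, he⟩ := hj
  refine Finset.mem_filter.2 ⟨hj, (E.deliversDuring_of_receive_quorum hq rfl ho he).mono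
    fun k' hk' => hT.antitone _ _ hk' (hT.receive _ _ _ _ he hP)⟩

/-- A receiver rejects the bundle only if it has delivered the identity, and then it has signed it
before. As the sender is correct, whatever was signed is the invoked triplet. -/
theorem signsDuring_of_receive {k₀ k : ℕ} {i j : Fin n} {m : M} {sn : ℕ}
    (hinv : E.event k₀ = .invoke i m sn) {κ : OutputId n} {S : Finset (Signature n M)}
    (ho : outputAt t E.event κ = some (.broadcast ⟨⟨m, sn, i⟩, S⟩))
    (he : E.event k = .receive j ⟨⟨m, sn, i⟩, S⟩ κ) :
    E.SignsDuring (· ≤ k) j ⟨m, sn, i⟩ := by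
  have hs : (E.state (k + 1) j).HasSigned sn i := by
    rcases react_receives (t := t) (.inl ⟨κ, he⟩) (E.sender_mem_of_broadcast ho) (E.state k j)
      with h | ⟨-, h, -⟩
    · exact E.hasSigned_mono k.le_succ (E.hasSigned_of_hasDelivered h)
    · exact h
  obtain ⟨a, ha, hsn, hj⟩ := hs
  obtain ⟨-, rfl⟩ := E.signed_eq_of_invoke hinv ha hsn hj
  exact (E.signsDuring_of_mem ha).mono fun _ => Nat.le_of_lt_succ

/-- Whoever receives the bundles of a quorum of signers delivers. -/
theorem deliversDuring_of_receives_signers {Q : ℕ → Prop} (hQ : ∀ k k', k ≤ k' → Q k' → Q k)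
    {k₀ : ℕ} {i j : Fin n} {m : M} {sn : ℕ} (hinv : E.event k₀ = .invoke i m sn)
    {B : Finset (Fin n)} (hB : n + t < 2 * B.card)
    (hr : ∀ p ∈ B, ∃ k κ S, E.event k = .receive j ⟨⟨m, sn, i⟩, S⟩ κ ∧
      outputAt t E.event κ = some (.broadcast ⟨⟨m, sn, i⟩, S⟩) ∧ ⟨p, ⟨m, sn, i⟩⟩ ∈ S ∧ Q k) :
    E.DeliversDuring Q j ⟨m, sn, i⟩ := by
  classical
  have : Nonempty (OutputId n) := ⟨⟨i, 0, 0⟩⟩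
  choose! k κ S he ho hS hQk using hr
  have hne : B.Nonempty := by
    rw [← Finset.card_pos]
    omega
  -- At the last of these receptions all signatures from `B` are saved, unless the identity was
  -- delivered earlier and bundles were rejected.
  obtain ⟨q, hq, hmax⟩ := Finset.exists_max_image B k hne
  suffices hd : (E.state (k q + 1) j).HasDelivered sn i by
    obtain ⟨a, ha, hsn, hj⟩ := hd
    obtain rfl := E.delivered_eq_of_invoke hinv ha hsn hj
    exact (E.deliversDuring_of_mem ha).mono
      fun _ h => hQ _ _ (Nat.le_of_lt_succ h) (hQk q hq)
  by_contra hd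
  have hrec : ∀ p ∈ B, _ := fun p hp => (react_receives (t := t) (.inl ⟨κ p, he p hp⟩)
    (E.sender_mem_of_broadcast (ho p hp)) (E.state (k p) j)).resolve_left
      fun h => hd (E.hasDelivered_mono ((hmax p hp).trans (k q).le_succ) h)
  refine hd ⟨⟨m, sn, i⟩, (hrec q hq).2.2 ?_, rfl, rfl⟩
  change n + t < 2 * ((E.state (k q + 1) j).sigsFor ⟨m, sn, i⟩).card
  have hsub : B ⊆ ((E.state (k q + 1) j).sigsFor ⟨m, sn, i⟩).image Signature.signer := by
    intro p hp
    refine Finset.mem_image.2 ⟨⟨p, ⟨m, sn, i⟩⟩, LocalState.mem_sigsFor.2 ⟨?_, rfl⟩, rfl⟩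
    exact E.saved_mono j (Nat.succ_le_succ (hmax p hp)) ((hrec p hp).1 _ (hS p hp) rfl)
  have := Finset.card_le_card hsub
  rw [card_signers_sigsFor] at this
  omega

/-- One round of communication: the participants in `A` have signed the triplet of an invocation. -/
theorem exists_round {P Q : ℕ → Prop} (hT : E.Transfers P Q) {k₀ : ℕ} {i : Fin n} {m : M}
    {sn : ℕ} (hinv : E.event k₀ = .invoke i m sn) {A : Finset (Fin n)} (hA : A ⊆ E.correct)
    (hs : ∀ p ∈ A, E.SignsDuring P p ⟨m, sn, i⟩) :
    ∃ R : Fin n → Finset (Fin n),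
      (∀ p ∈ A, R p ⊆ E.correct ∧ E.c - d ≤ (R p).card ∧
        (E.correct.filter fun j => j ∉ R p).card ≤ d ∧
        ∀ j ∈ R p, E.SignsDuring Q j ⟨m, sn, i⟩) ∧
      ∀ j, n + t < 2 * (A.filter fun p => j ∈ R p).card → E.DeliversDuring Q j ⟨m, sn, i⟩ := by
  have : Nonempty (OutputId n) := ⟨⟨i, 0, 0⟩⟩
  choose! κ S hκ ho hS hP using hs
  refine ⟨fun p => E.receivers (κ p) ⟨⟨m, sn, i⟩, S p⟩, fun p hp => ?_, fun j hj => ?_⟩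
  · have hc : (κ p).proc ∈ E.correct := by rw [hκ p hp]; exact hA hp
    refine ⟨fun j hj => (E.mem_receivers.1 hj).1, E.c_le_card_receivers hc (ho p hp),
      E.card_filter_notMem_receivers hc (ho p hp), fun j hj => ?_⟩
    obtain ⟨-, k, he⟩ := E.mem_receivers.1 hj
    exact (E.signsDuring_of_receive hinv (ho p hp) he).mono
      fun k' hk' => hT.antitone _ _ hk' (hT.receive _ _ _ _ he (hP p hp))
  · refine E.deliversDuring_of_receives_signers hT.antitone hinv hj fun p hp => ?_
    obtain ⟨hp, hjp⟩ := Finset.mem_filter.1 hp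
    obtain ⟨-, k, he⟩ := E.mem_receivers.1 hjp
    exact ⟨k, κ p, S p, he, ho p hp, hS p hp, hT.receive _ _ _ _ he (hP p hp)⟩

open Classical in
/-- The correct participants that sign `a` at a step with `P`. -/
noncomputable def signers (P : ℕ → Prop) (a : AppMsg n M) : Finset (Fin n) :=
  E.correct.filter fun p => E.SignsDuring P p a

theorem mem_signers {P : ℕ → Prop} {a : AppMsg n M} {p : Fin n} :
    p ∈ E.signers P a ↔ p ∈ E.correct ∧ E.SignsDuring P p a := by
  simp [signers]

/-- This is the round that starts from the invoker alone: the receivers of its first bundle sign. -/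
theorem c_sub_le_card_signers {P Q : ℕ → Prop} (hT : E.Transfers P Q) {k₀ : ℕ} {i : Fin n}
    {m : M} {sn : ℕ} (hinv : E.event k₀ = .invoke i m sn) (hP : ∀ k ≤ k₀, P k) :
    E.c - d ≤ (E.signers Q ⟨m, sn, i⟩).card := by
  have hi := E.invoke_correct _ _ _ _ hinv
  obtain ⟨R, hR, -⟩ := E.exists_round hT hinv (A := {i}) (by simpa using hi)
    (by simpa using (E.signsDuring_invoke hinv).mono hP)
  obtain ⟨h₁, h₂, -, h₃⟩ := hR i (by simp)
  exact h₂.trans (Finset.card_le_card fun j hj => E.mem_signers.2 ⟨h₁ hj, h₃ j hj⟩)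

/-- If the bundles of the signers are received by few participants only, somebody delivers. -/
theorem exists_deliversDuring {P Q : ℕ → Prop} (hT : E.Transfers P Q) {k₀ : ℕ} {i : Fin n}
    {m : M} {sn : ℕ} (hinv : E.event k₀ = .invoke i m sn)
    (h : (n + t) / 2 * (E.signers Q ⟨m, sn, i⟩).card <
      (E.signers P ⟨m, sn, i⟩).card * (E.c - d)) :
    ∃ j ∈ E.correct, E.DeliversDuring Q j ⟨m, sn, i⟩ := by
  obtain ⟨R, hR, hdel⟩ := E.exists_round hT hinv (A := E.signers P ⟨m, sn, i⟩)
    (fun p hp => (E.mem_signers.1 hp).1) (fun p hp => (E.mem_signers.1 hp).2)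
  -- All receivers are themselves signers by the end of the round, so the receptions concentrate on
  -- the signers for `Q` and not on all correct participants.
  obtain ⟨j, hj, hj'⟩ := exists_many_of_card_lt (R := R)
    (fun p hp j hj => E.mem_signers.2 ⟨(hR p hp).1 hj, (hR p hp).2.2.2 j hj⟩)
    (fun p hp => (hR p hp).2.1) h
  exact ⟨j, (E.mem_signers.1 hj).1, hdel j (by omega)⟩

-- Each signer's bundle misses at most d correct participants; with enough signers, all but at most
-- d correct participants receive more than ⌊(n+t)/2⌋ of these bundles.
open Classical in
theorem c_sub_le_card_delivers {P Q : ℕ → Prop} (hT : E.Transfers P Q) {k₀ : ℕ} {i : Fin n}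
    {m : M} {sn : ℕ} (hinv : E.event k₀ = .invoke i m sn)
    (h : (d + 1) * ((n + t) / 2) < (E.signers P ⟨m, sn, i⟩).card) :
    E.c - d ≤ (E.correct.filter fun j => E.DeliversDuring Q j ⟨m, sn, i⟩).card := by
  obtain ⟨R, hR, hdel⟩ := E.exists_round hT hinv (A := E.signers P ⟨m, sn, i⟩)
    (fun p hp => (E.mem_signers.1 hp).1) (fun p hp => (E.mem_signers.1 hp).2)
  have h₁ := card_le_card_filter_add (C := E.correct) (fun p hp => (hR p hp).2.2.1) h
  have h₂ : (E.correct.filter fun j => (n + t) / 2 <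
      ((E.signers P ⟨m, sn, i⟩).filter fun p => j ∈ R p).card).card ≤
      (E.correct.filter fun j => E.DeliversDuring Q j ⟨m, sn, i⟩).card := by
    refine Finset.card_le_card fun j hj => ?_
    obtain ⟨hj, hj'⟩ := Finset.mem_filter.1 hj
    exact Finset.mem_filter.2 ⟨hj, hdel j (by omega)⟩
  unfold c
  omega

/-- Somebody delivers as soon as the set of signers stagnates for a round. -/
theorem exists_deliversDuring_of_card_le (hn : 3 * t + 2 * d < n) {P Q : ℕ → Prop}
    (hT : E.Transfers P Q) {k₀ : ℕ} {i : Fin n} {m : M} {sn : ℕ}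
    (hinv : E.event k₀ = .invoke i m sn) (hP : ∀ k ≤ k₀, P k)
    (h : (E.signers Q ⟨m, sn, i⟩).card ≤ (E.signers P ⟨m, sn, i⟩).card) :
    ∃ j ∈ E.correct, E.DeliversDuring Q j ⟨m, sn, i⟩ := by
  apply E.exists_deliversDuring hT hinv
  have hi := E.invoke_correct _ _ _ _ hinv
  have hpos : 0 < (E.signers P ⟨m, sn, i⟩).card :=
    Finset.card_pos.2 ⟨i, E.mem_signers.2 ⟨hi, (E.signsDuring_invoke hinv).mono hP⟩⟩
  -- From c ≥ n-t, since 2(n-t-d) > n+t is the assumption n > 3t+2d.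
  have hc : (n + t) / 2 < E.c - d := by
    have := E.card_correct
    unfold c
    omega
  calc _ ≤ (n + t) / 2 * (E.signers P ⟨m, sn, i⟩).card := Nat.mul_le_mul_left _ h
    _ = (E.signers P ⟨m, sn, i⟩).card * ((n + t) / 2) := mul_comm _ _
    _ < _ := Nat.mul_lt_mul_of_pos_left hc hpos

/-! ### The specification -/

theorem satisfiesMBRB (hn : 3 * t + 2 * d < n) : E.SatisfiesMBRB (E.c - d) where
  validity κ a _ hc h := E.invoked_of_deliversAt hc h
  no_duplication κ κ' a a' _ hp h h' hsn hj := E.delivery_unique hp h h' hsn hj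
  no_duplicity i i' a a' _ _ _ h h' hsn hj := h.unique h' hsn hj
  local_delivery k i m sn _ he := by
    obtain ⟨j, hj, h⟩ := E.exists_deliversDuring_of_card_le hn E.transfers_true he
      (fun _ _ => trivial) le_rfl
    exact ⟨j, hj, h.delivers⟩
  global_delivery i a hi h := by
    classical
    obtain ⟨κ, h₁, h₂⟩ := h
    refine (DeliversDuring.global E.transfers_true hi ⟨κ, h₁, h₂, trivial⟩).trans
      (Finset.card_le_card fun j hj => ?_)
    obtain ⟨hj, h⟩ := Finset.mem_filter.1 hj
    exact Finset.mem_filter.2 ⟨hj, h.delivers⟩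

/-! ### Time bounds -/

theorem card_signers_le (P : ℕ → Prop) (a : AppMsg n M) : (E.signers P a).card ≤ E.c :=
  Finset.card_le_card fun _ hp => (E.mem_signers.1 hp).1

open Classical in
theorem deliversWithin_iff {δ : ℝ} {time : ℕ → ℝ} {l r : ℕ} :
    E.DeliversWithin δ time l r ↔ ∀ k i m sn, E.event k = .invoke i m sn →
      l ≤ (E.correct.filter fun j =>
        E.DeliversDuring (fun k' => time k' ≤ time k + r * δ) j ⟨m, sn, i⟩).card := by
  refine ⟨fun h k i m sn he => ?_, fun h k i m sn _ he => ?_⟩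
  · exact h k i m sn (E.invoke_correct _ _ _ _ he) he
  · exact h k i m sn he

variable {E} {δ : ℝ} {time : ℕ → ℝ}

theorem IsTiming.transfers_round (h : E.IsTiming δ time) (x : ℝ) (r : ℕ) :
    E.Transfers (fun k => time k ≤ x + r * δ) (fun k => time k ≤ x + (r + 1 : ℕ) * δ) := by
  have := h.transfers (x + r * δ)
  have e : x + r * δ + δ = x + (r + 1 : ℕ) * δ := by push_cast; ring
  rwa [e] at this

theorem IsTiming.le_of_le (h : E.IsTiming δ time) {k₀ : ℕ} (r : ℕ) :
    ∀ k ≤ k₀, time k ≤ time k₀ + r * δ := by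
  intro k hk
  have := h.mono hk
  have := h.delay_pos
  have : 0 ≤ r * δ := by positivity
  linarith

theorem IsTiming.deliversWithin_two (h : E.IsTiming δ time)
    (hd : d * ((n + t) / 2 + 1) + (n + t) / 2 < E.c) :
    E.DeliversWithin δ time (E.c - d) 2 := by
  rw [deliversWithin_iff]
  intro k i m sn he
  refine E.c_sub_le_card_delivers (h.transfers_round (time k) 1) he ?_
  have := E.c_sub_le_card_signers (h.transfers_round (time k) 0) he (h.le_of_le 0)
  refine lt_of_lt_of_le ?_ this
  have : (d + 1) * ((n + t) / 2) + d = d * ((n + t) / 2 + 1) + (n + t) / 2 := by ring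
  omega

theorem IsTiming.deliversWithin_three (h : E.IsTiming δ time)
    (hd : (n + t) / 2 * E.c < (E.c - d) * (E.c - d)) :
    E.DeliversWithin δ time (E.c - d) 3 := by
  rw [deliversWithin_iff]
  intro k i m sn he
  have h₁ := E.c_sub_le_card_signers (h.transfers_round (time k) 0) he (h.le_of_le 0)
  obtain ⟨j, hj, hdel⟩ := E.exists_deliversDuring (h.transfers_round (time k) 1) he
    ((Nat.mul_le_mul_left _ (E.card_signers_le _ _)).trans_lt
      (hd.trans_le (Nat.mul_le_mul_right _ h₁)))
  exact hdel.global (h.transfers_round (time k) 2) hj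

theorem IsTiming.deliversWithin (h : E.IsTiming δ time) (hn : 3 * t + 2 * d < n) :
    E.DeliversWithin δ time (E.c - d) (n + 2) := by
  rw [deliversWithin_iff]
  intro k i m sn he
  let s : ℕ → ℕ := fun r => (E.signers (fun k' => time k' ≤ time k + r * δ) ⟨m, sn, i⟩).card
  -- Growth in each of the rounds 0, ..., n would produce n+1 signers among n participants.
  -- Stagnation in round r ≤ n gives a delivery by time n+1, and one more step spreads it.
  obtain ⟨r, hr, hs⟩ : ∃ r ≤ n, s (r + 1) ≤ s r := by
    by_contra! hcon
    have hge : ∀ r ≤ n + 1, r ≤ s r := by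
      intro r
      induction r with
      | zero => simp
      | succ r ih =>
        intro hr
        have h₁ := ih (by omega)
        have h₂ := hcon r (by omega)
        omega
    have h₁ := hge (n + 1) le_rfl
    have h₂ : s (n + 1) ≤ n := (Finset.card_le_univ _).trans (Fintype.card_fin n).le
    omega
  obtain ⟨j, hj, hdel⟩ := E.exists_deliversDuring_of_card_le hn (h.transfers_round (time k) r) he
    (h.le_of_le r) hs
  refine DeliversDuring.global (h.transfers_round (time k) (n + 1)) hj (hdel.mono fun k' hk' => ?_)
  have := h.delay_pos
  have : ((r + 1 : ℕ) : ℝ) * δ ≤ (n + 1 : ℕ) * δ := by gcongr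
  linarith

end Execution

theorem lt_of_lt_div_two_rounds {c d F : ℕ} (h : (d : ℝ) < ((c : ℝ) - F) / ((F : ℝ) + 1)) :
    d * (F + 1) + F < c := by
  rw [lt_div_iff₀ (by positivity)] at h
  have : ((d * (F + 1) + F : ℕ) : ℝ) < c := by
    push_cast
    linarith
  exact_mod_cast this

/-- The floor only helps, so squaring suffices; the positivity of c-d justifies both the squaring
and the truncated subtraction. -/
theorem mul_lt_of_lt_sub_sqrt {n t c d : ℕ}
    (h : (d : ℝ) < (c : ℝ) - Real.sqrt ((c : ℝ) * (((n : ℝ) + (t : ℝ)) / 2))) :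
    (n + t) / 2 * c < (c - d) * (c - d) := by
  have hs : Real.sqrt ((c : ℝ) * (((n : ℝ) + (t : ℝ)) / 2)) < (c : ℝ) - d := by linarith
  have hpos : (0 : ℝ) < (c : ℝ) - d := (Real.sqrt_nonneg _).trans_lt hs
  have hdc : d ≤ c := by
    have : (d : ℝ) ≤ c := by linarith
    exact_mod_cast this
  rw [Real.sqrt_lt' hpos] at hs
  have hF : (((n + t) / 2 : ℕ) : ℝ) ≤ ((n : ℝ) + t) / 2 := by
    have := Nat.cast_div_le (α := ℝ) (m := n + t) (n := 2)
    exact_mod_cast this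
  have : (((n + t) / 2 * c : ℕ) : ℝ) < ((c - d) * (c - d) : ℕ) := by
    push_cast [Nat.cast_sub hdc]
    have : (((n + t) / 2 : ℕ) : ℝ) * c ≤ (((n : ℝ) + t) / 2) * c := by gcongr
    nlinarith
  exact_mod_cast this

end MBRB

theorem theorem1 (n t d : ℕ) (M : Type*) (hn : 3 * t + 2 * d < n) :
    (∀ E : MBRB.Execution n t d M,
      E.SatisfiesMBRB (E.c - d) ∧
      E.MessageCostLE (2 * n ^ 2) ∧
      ∀ (δ : ℝ) (time : ℕ → ℝ), E.IsTiming δ time →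
        ((d : ℝ) < ((E.c : ℝ) - (((n + t) / 2 : ℕ) : ℝ)) / ((((n + t) / 2 : ℕ) : ℝ) + 1) →
          E.DeliversWithin δ time (E.c - d) 2) ∧
        ((d : ℝ) < (E.c : ℝ) - Real.sqrt ((E.c : ℝ) * (((n : ℝ) + (t : ℝ)) / 2)) →
          E.DeliversWithin δ time (E.c - d) 3)) ∧
    (∃ r : ℕ, 3 < r ∧
      ∀ (E : MBRB.Execution n t d M) (δ : ℝ) (time : ℕ → ℝ), E.IsTiming δ time →
        ¬ ((d : ℝ) < ((E.c : ℝ) - (((n + t) / 2 : ℕ) : ℝ)) / ((((n + t) / 2 : ℕ) : ℝ) + 1)) →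
        ¬ ((d : ℝ) < (E.c : ℝ) - Real.sqrt ((E.c : ℝ) * (((n : ℝ) + (t : ℝ)) / 2))) →
          E.DeliversWithin δ time (E.c - d) r) := by
  -- The bound n+2 is relaxed to n+4, which exceeds 3 for every n.
  refine ⟨fun E => ⟨E.satisfiesMBRB hn, E.messageCostLE,
    fun δ time h => ⟨fun hd => ?_, fun hd => ?_⟩⟩, n + 4, by omega, fun E δ time h _ _ => ?_⟩
  · exact h.deliversWithin_two (MBRB.lt_of_lt_div_two_rounds hd)
  · exact h.deliversWithin_three (MBRB.mul_lt_of_lt_sub_sqrt hd)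
  · classical
    have h₁ := h.deliversWithin hn
    rw [MBRB.Execution.deliversWithin_iff] at h₁ ⊢
    intro k i m sn he
    refine (h₁ k i m sn he).trans (Finset.card_le_card fun j hj => ?_)
    obtain ⟨hj, hdel⟩ := Finset.mem_filter.1 hj
    refine Finset.mem_filter.2 ⟨hj, hdel.mono fun k' hk' => ?_⟩
    have := h.delay_pos
    have : ((n + 2 : ℕ) : ℝ) * δ ≤ (n + 4 : ℕ) * δ := by gcongr; norm_num
    linarith
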